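/- Let $P$ be a finite poset with least element $\hat 0$ and greatest element $\hat 1$. Write $x\lessdot y$ if $y$ covers $x$. A \emph{root} $r$ of $x$ is a maximal chain of $[\hat 0,x]$; for $x\le y$, $[x,y]_r$ denotes $[x,y]$ together with a root $r$ of $x$ (a rooted interval). An atom of $[x,y]$ (where $x<y$) is an element $a$ with $x\lessdot a\le y$. \textbf{Labelings.} A CE-labeling $\lambda$ assigns to each root $r$ of $x$ and each $x\lessdot u$ a label $\lambda(r,x,u)$ in a poset $\Lambda$. The label sequence of a maximal chain $x\lessdot x_1\lessdot\dots\lessdot x_t=y$ of $[x,y]_r$ is $\lambda(r,x,x_1),\lambda(r\cup\{x_1\},x_1,x_2),\dots,\lambda(r\cup\{x_1,\dots,x_{t-1}\},x_{t-1},x_t)$; label sequences are compared by the strict dictionary order (a proper prefix comes first). A piece $u\lessdot v\lessdot w$ with root $r$ of $u$ is a topological ascent if its label sequence strictly precedes those of all other maximal chains of $[u,w]_r$; a maximal chain of a rooted interval is topologically ascending if all its pieces $u\lessdot v\lessdot w$, each rooted by the part of the chain (with $r$) up to $u$, are topological ascents. $\lambda$ is a \emph{TCL-labeling} if every rooted interval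 $[x,y]_r$ has a unique topologically ascending maximal chain and the label sequence of this chain strictly lexicographically precedes those of all other maximal chains of $[x,y]_r$. A TCL-labeling is a \emph{CC-labeling} if, moreover, in every rooted interval distinct maximal chains have distinct label sequences, none of which is a prefix of another. $P$ is \emph{TCL-shellable} (\emph{CC-shellable}) if it has a TCL-labeling (CC-labeling). \textbf{First atoms.} A \emph{recursive first atom set} (RFAS) $\Omega$ assigns to each $x<y$ in $P$ and each root $r$ of $x$ an atom $\Omega(r,x,y)$ of $[x,y]$, called the first atom of $[x,y]_r$, such that whenever $x\lessdot a<y$ and $b=\Omega(r\cup\{a\},a,y)$: (i) $a=\Omega(r,x,y)$ if and only if $a=\Omega(r,x,b)$; (ii) if $a\ne\Omega(r,x,y)$, then there are $p\ge 1$, atoms $a_1,\dots,a_p$ of $[x,y]$ and elements $b_1,\dots,b_{p-1}$ with $a_p=\Omega(r,x,b)$, $a_1=\Omega(r,x,y)$, and $b_i=\Omega(r\cup\{a_{i+1}\},a_{i+1},y)$, $a_i=\Omega(r,x,b_i)$ for $1\le i\le p-1$. The first atom chain $c(r,x,y)$ is the maximal chain $x=z_0\lessdot z_1\lessdot\dots\lessdot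 z_q=y$ with $z_{i+1}=\Omega(r\cup\{z_0,\dots,z_i\},z_i,y)$ for all $i<q$. For maximal chains $m,m'$ of $P$ write $m\to m'$ if there are $x\lessdot y\lessdot z$ in $m'$ such that, with $r$ the part of $m'$ up to $x$, $y\ne\Omega(r,x,z)$, and $m$ is obtained from $m'$ by replacing the part between $x$ and $z$ by $c(r,x,z)$. Let $\preceq$ be the reflexive and transitive closure of $\to$; the set of maximal chains of $P$ with $\preceq$ is denoted $\mathcal M_\Omega$. $\Omega$ is \emph{labeling-compatible} (an LCRFAS) if (LC) there is a linear extension $m_1,\dots,m_t$ of $\mathcal M_\Omega$ (an enumeration of all maximal chains in which $m_i\preceq m_j$ implies $i\le j$) such that for all $i<j<k$, every root $r$ of an element $x$, and all $x\lessdot y\lessdot z$ and $x\lessdot y'$: if $m_i$ and $m_k$ contain $r\cup\{y,z\}$ and $m_j$ contains $r\cup\{y'\}$, then $y'=y$. \textbf{Theorem.} For every finite bounded poset $P$ the following are equivalent: $P$ admits an LCRFAS; $P$ is TCL-shellable; $P$ is CC-shellable. -/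

import Mathlib

universe u v

namespace LexShelling

section Chains

variable {P : Type u} [PartialOrder P]

/-- `c` is a saturated chain `x = x₀ ⋖ x₁ ⋖ ⋯ ⋖ x_t = y`, i.e. a maximal chain of the interval
`[x, y]`, written as the list of its elements from bottom to top (both `x` and `y` included). -/
def IsSatChain (x y : P) (c : List P) : Prop :=
  c.IsChain (· ⋖ ·) ∧ c.head? = some x ∧ c.getLast? = some y

/-- `r` is a root of `x`: a maximal chain of `[0̂, x]`. -/
def IsRoot [OrderBot P] (r : List P) (x : P) : Prop :=
  IsSatChain ⊥ x r

/-- The maximal chains of the bounded poset `P`. -/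
def MaxChain (P : Type u) [PartialOrder P] [BoundedOrder P] : Type u :=
  {m : List P // IsSatChain (⊥ : P) ⊤ m}

end Chains

section Labelings

/-- A chain-edge labeling: `lab r x u` is the label of the rooted cover relation `[x, u]_r`.
Only the values at triples with `r` a root of `x` and `x ⋖ u` are ever used. -/
def CELabeling (P : Type u) (Λ : Type v) : Type (max u v) :=
  List P → P → P → Λ

variable {P : Type u} [PartialOrder P] {Λ : Type v} [PartialOrder Λ]

/-- The label sequence of a saturated chain `x ⋖ x₁ ⋖ ⋯ ⋖ x_t` (second argument) with respect to
the root `r` of `x` (first argument):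
`lab r x x₁, lab (r ∪ {x₁}) x₁ x₂, …, lab (r ∪ {x₁, …, x_{t-1}}) x_{t-1} x_t`. -/
def labelSeq (lab : CELabeling P Λ) : List P → List P → List Λ
  | r, x :: u :: c => lab r x u :: labelSeq lab (r ++ [u]) (u :: c)
  | _, _ => []

/-- Strict lexicographic (dictionary) order on label sequences: `s` is a proper prefix of `t`, or
at the first position where they differ the entry of `s` is smaller in `Λ`. -/
def LexLT (s t : List Λ) : Prop :=
  List.Lex (· < ·) s t

/-- For `u ⋖ v ⋖ w` and a root `r` of `u`: the pair `[u, v]_r`, `[v, w]_{r ∪ {v}}` is a topological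
ascent, i.e. its pair of labels lexicographically precedes the label sequences of all other maximal
chains of `[u, w]_r`. -/
def IsTopAscent (lab : CELabeling P Λ) (r : List P) (u v w : P) : Prop :=
  ∀ c, IsSatChain u w c → c ≠ [u, v, w] → LexLT (labelSeq lab r [u, v, w]) (labelSeq lab r c)

/-- The saturated chain given as second argument, with root `r` (first argument), consists entirely
of topological ascents. -/
def IsTopAscending (lab : CELabeling P Λ) : List P → List P → Prop
  | r, u :: v :: w :: c =>
      IsTopAscent lab r u v w ∧ IsTopAscending lab (r ++ [v]) (v :: w :: c)
  | _, _ => True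

/-- A TCL-labeling: every rooted interval `[x, y]_r` has a unique topologically ascending maximal
chain, and this chain strictly lexicographically precedes all other maximal chains of `[x, y]_r`. -/
def IsTCLLabeling [OrderBot P] (lab : CELabeling P Λ) : Prop :=
  ∀ (r : List P) (x y : P), IsRoot r x → x ≤ y →
    ∃ c, IsSatChain x y c ∧ IsTopAscending lab r c ∧
      (∀ c', IsSatChain x y c' → IsTopAscending lab r c' → c' = c) ∧
      (∀ c', IsSatChain x y c' → c' ≠ c → LexLT (labelSeq lab r c) (labelSeq lab r c'))

/-- A CC-labeling: as for a TCL-labeling, and moreover in every rooted interval the label sequences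
of the maximal chains are distinct and none is a prefix of another. -/
def IsCCLabeling [OrderBot P] (lab : CELabeling P Λ) : Prop :=
  IsTCLLabeling lab ∧
  ∀ (r : List P) (x y : P), IsRoot r x → x ≤ y →
    ∀ c c', IsSatChain x y c → IsSatChain x y c' → c ≠ c' →
      labelSeq lab r c ≠ labelSeq lab r c' ∧ ¬ labelSeq lab r c <+: labelSeq lab r c'

/-- `P` admits a TCL-labeling with values in some poset `Λ`. -/
def TCLShellable (P : Type u) [PartialOrder P] [OrderBot P] : Prop :=
  ∃ (Λ : Type v) (_ : PartialOrder Λ) (lab : CELabeling P Λ), IsTCLLabeling lab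

/-- `P` admits a CC-labeling with values in some poset `Λ`. -/
def CCShellable (P : Type u) [PartialOrder P] [OrderBot P] : Prop :=
  ∃ (Λ : Type v) (_ : PartialOrder Λ) (lab : CELabeling P Λ), IsCCLabeling lab

end Labelings

section FirstAtoms

variable {P : Type u} [PartialOrder P]

/-- `Ω` is a recursive first atom set; `Ω r x y` is the first atom of `[x, y]_r`. Only the values at
triples with `r` a root of `x` and `x < y` are ever used. In the two conditions, `a < y` expresses
that `[a, y]` has a first atom `b = Ω (r ∪ {a}) a y`. (For a poset of length at most `1` the two
conditions are vacuous.) -/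
structure IsRFAS [OrderBot P] (Ω : List P → P → P → P) : Prop where
  /-- `Ω r x y` is an atom of `[x, y]`. -/
  atom : ∀ (r : List P) (x y : P), IsRoot r x → x < y → x ⋖ Ω r x y ∧ Ω r x y ≤ y
  /-- `a` is first in `[x, y]_r` if and only if `a` is first in `[x, b]_r`. -/
  cond_i : ∀ (r : List P) (x y a b : P), IsRoot r x → x ⋖ a → a < y → b = Ω (r ++ [a]) a y →
    (a = Ω r x y ↔ a = Ω r x b)
  /-- If `a` is not first in `[x, y]_r`, there are atoms `a₁, …, a_p` of `[x, y]` and elements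
  `b₁, …, b_{p-1}` leading from the first atom `a₁` of `[x, y]_r` to the first atom `a_p` of
  `[x, b]_r`. -/
  cond_ii : ∀ (r : List P) (x y a b : P), IsRoot r x → x ⋖ a → a < y → b = Ω (r ++ [a]) a y →
    a ≠ Ω r x y →
    ∃ (p : ℕ) (as bs : ℕ → P), 1 ≤ p ∧
      (∀ i, 1 ≤ i → i ≤ p → x ⋖ as i ∧ as i ≤ y) ∧
      as p = Ω r x b ∧
      as 1 = Ω r x y ∧
      ∀ i, 1 ≤ i → i < p →
        bs i = Ω (r ++ [as (i + 1)]) (as (i + 1)) y ∧ as i = Ω r x (bs i)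

/-- Along the chain `z₀ ⋖ z₁ ⋖ ⋯` given as second argument, with root `r` of `z₀` (first argument),
each `z_{i+1}` is the first atom of `[z_i, y]_{r ∪ {z₀, …, z_i}}`. -/
def FollowsFirstAtoms (Ω : List P → P → P → P) (y : P) : List P → List P → Prop
  | r, z :: z' :: c => z' = Ω r z y ∧ FollowsFirstAtoms Ω y (r ++ [z']) (z' :: c)
  | _, _ => True

/-- `c` is the first atom chain `c(r, x, y)` of the rooted interval `[x, y]_r`. -/
def IsFirstAtomChain (Ω : List P → P → P → P) (r : List P) (x y : P) (c : List P) : Prop :=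
  IsSatChain x y c ∧ FollowsFirstAtoms Ω y r c

/-- In a chain whose part up to `x` is `r`, the piece `x ⋖ y ⋖ z` is a pseudo descent: `y` is not
the first atom of `[x, z]_r`. -/
def IsPseudoDescent (Ω : List P → P → P → P) (r : List P) (x y z : P) : Prop :=
  x ⋖ y ∧ y ⋖ z ∧ y ≠ Ω r x z

/-- The relation `m → m'` on maximal chains: there are `x ⋖ y ⋖ z` with `x` and `z` in both chains,
which agree below `x` (part `r`, a root of `x`) and above `z` (part `d`), such that `x ⋖ y ⋖ z` is a
pseudo descent of `m'` and `m` follows the first atom chain `c(r, x, z)` between `x` and `z`. Here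
`c.tail` is `c` without its bottom element `x`, which is already the last element of `r`. -/
def Arrow [BoundedOrder P] (Ω : List P → P → P → P) (m m' : MaxChain P) : Prop :=
  ∃ (r c d : List P) (x y z : P), IsRoot r x ∧
    IsPseudoDescent Ω r x y z ∧ m'.1 = r ++ [y, z] ++ d ∧
    IsFirstAtomChain Ω r x z c ∧ m.1 = r ++ c.tail ++ d

/-- The relation `⪯` on maximal chains: the reflexive and transitive closure of `m → m'`. -/
def ChainLE [BoundedOrder P] (Ω : List P → P → P → P) : MaxChain P → MaxChain P → Prop :=
  Relation.ReflTransGen (Arrow Ω)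

/-- The enumeration `Γ : m₁, …, m_t` of all maximal chains is a linear extension of `⪯`. -/
def IsLinearExtension [BoundedOrder P] (Ω : List P → P → P → P) {t : ℕ}
    (Γ : Fin t ≃ MaxChain P) : Prop :=
  ∀ i j, ChainLE Ω (Γ i) (Γ j) → i ≤ j

/-- Condition (LC): some linear extension `m₁, …, m_t` of `⪯` is such that for `i < j < k`, whenever
`m_i` and `m_k` contain `r ∪ {x ⋖ y ⋖ z}` and `m_j` contains `r ∪ {x ⋖ y'}`, where `r` is a root of
`x`, then `y' = y`. (A maximal chain contains a saturated chain that starts at `0̂` exactly when the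
latter is an initial segment of it.) -/
def SatisfiesLC [BoundedOrder P] (Ω : List P → P → P → P) : Prop :=
  ∃ (t : ℕ) (Γ : Fin t ≃ MaxChain P), IsLinearExtension Ω Γ ∧
    ∀ i j k : Fin t, i < j → j < k →
      ∀ (r : List P) (x y y' z : P), IsRoot r x → x ⋖ y → y ⋖ z → x ⋖ y' →
        r ++ [y, z] <+: (Γ i).1 → r ++ [y, z] <+: (Γ k).1 → r ++ [y'] <+: (Γ j).1 → y' = y

/-- `P` admits a labeling-compatible recursive first atom set. -/
def AdmitsLCRFAS (P : Type u) [PartialOrder P] [BoundedOrder P] : Prop :=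
  ∃ Ω : List P → P → P → P, IsRFAS Ω ∧ SatisfiesLC Ω

end FirstAtoms

end LexShelling

/-! Labelings and orders of the maximal chains are translated into each other.

From a TCL-labeling, take as first atom the atom on the topologically ascending chain (`ascAtom`).
Being ascending is a local property, which gives (i). For (ii), passing from `a` to the first atom
of `[x, b]_r` strictly lowers the label sequence of the ascending continuation, so finitely many
such passages reach the first atom (`IsTCLLabeling.isRFAS`). For (LC), linearize the labels and
break ties by the bottom of the edge. Label sequences then determine maximal chains, and sorting by
them gives a linear extension. Two chains through `r ∪ {y, z}` share all labels up to that of `y ⋖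
z`; so does every chain between them, and that last label reveals `y` (`IsTCLLabeling.satisfiesLC`).

Conversely, given an enumeration, call a position a cut for `r` if no family of chains through some
`r ∪ {y}` straddles it, and label the edge to `y` by the last cut not after its family (`cutLabel`).
Where two chains part, the labels increase weakly along the enumeration; interleaved families may
tie, but (LC) makes the next labels increase strictly (`cutLabel_lt_cutLabel`). So label sequences
are ordered like the chains, and always by a true difference, never by a prefix
(`lexDiff_labelSeq`). A chain other than the first atom chain has a pseudo descent, whose
replacement comes earlier; hence the first atom chain is least (`IsRFAS.eq_or_lt_index`), and the
ascending chains are exactly the first atom chains. -/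

namespace LexShelling

/-! ### Dictionary order on finite sequences -/

section ListLex

theorem lexLT_trans {α : Type*} [PartialOrder α] {s t w : List α} (h₁ : LexLT s t)
    (h₂ : LexLT t w) : LexLT s w := by
  unfold LexLT at *
  induction h₁ generalizing w with
  | nil => cases h₂ <;> exact List.Lex.nil
  | cons _ ih =>
    cases h₂ with
    | cons h => exact List.Lex.cons (ih h)
    | rel h => exact List.Lex.rel h
  | rel h =>
    cases h₂ with
    | cons _ => exact List.Lex.rel h
    | rel h' => exact List.Lex.rel (h.trans h')

theorem lexLT_asymm {α : Type*} [PartialOrder α] {s t : List α} (h₁ : LexLT s t) :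
    ¬ LexLT t s :=
  Std.Asymm.asymm (r := List.Lex (· < · : α → α → Prop)) s t h₁

/-- The pair `(a, b)` strictly precedes `(a', b')` in the lexicographic order. -/
def PairLT {α : Type*} [LT α] (a b a' b' : α) : Prop :=
  a < a' ∨ a = a' ∧ b < b'

theorem PairLT.lexLT {α : Type*} [PartialOrder α] {a b a' b' : α} (h : PairLT a b a' b')
    (s t : List α) : LexLT (a :: b :: s) (a' :: b' :: t) := by
  rcases h with h | ⟨rfl, h⟩
  · exact List.Lex.rel h
  · exact List.Lex.cons (List.Lex.rel h)

/-- A sequence with at least two entries is no proper prefix of a two-entry one, so the first two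
positions decide. -/
theorem pairLT_of_lexLT {α : Type*} [PartialOrder α] {a b a' b' : α} {s : List α}
    (h : LexLT (a :: b :: s) [a', b']) : PairLT a b a' b' := by
  cases h with
  | rel h => exact Or.inl h
  | cons h =>
    cases h with
    | rel h => exact Or.inr ⟨rfl, h⟩
    | cons h => cases h

theorem LexLT.append_left {α : Type*} [PartialOrder α] {s t : List α} (p : List α)
    (h : LexLT s t) : LexLT (p ++ s) (p ++ t) := by
  induction p with
  | nil => exact h
  | cons a p ih => exact List.Lex.cons ih

theorem LexLT.of_append {α : Type*} [PartialOrder α] {p q s t : List α}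
    (hl : p.length = q.length) (h : LexLT (p ++ s) (q ++ t)) : p = q ∨ LexLT p q := by
  induction p generalizing q with
  | nil => exact Or.inl (List.length_eq_zero_iff.1 hl.symm).symm
  | cons a p ih =>
    cases q with
    | nil => simp at hl
    | cons b q =>
      simp only [List.length_cons, Nat.add_right_cancel_iff] at hl
      cases h with
      | rel h => exact Or.inr (List.Lex.rel h)
      | cons h => exact (ih hl h).imp (congrArg _) List.Lex.cons

/-- Two lists differ at some position, and at the first such position the entry of the first list
is smaller. -/
def LexDiff {α : Type*} [LT α] (s t : List α) : Prop :=
  ∃ p a b s' t', s = p ++ a :: s' ∧ t = p ++ b :: t' ∧ a < b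

theorem LexDiff.cons {α : Type*} [LT α] {s t : List α} (a : α) (h : LexDiff s t) :
    LexDiff (a :: s) (a :: t) := by
  obtain ⟨p, b, c, s', t', rfl, rfl, h⟩ := h
  exact ⟨a :: p, b, c, s', t', rfl, rfl, h⟩

theorem PairLT.lexDiff {α : Type*} [LT α] {a b a' b' : α} (h : PairLT a b a' b')
    (s t : List α) : LexDiff (a :: b :: s) (a' :: b' :: t) := by
  rcases h with h | ⟨rfl, h⟩
  · exact ⟨[], _, _, _, _, rfl, rfl, h⟩
  · exact ⟨[a], _, _, _, _, rfl, rfl, h⟩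

theorem LexDiff.lexLT {α : Type*} [PartialOrder α] {s t : List α} (h : LexDiff s t) :
    LexLT s t := by
  obtain ⟨p, b, c, s', t', rfl, rfl, h⟩ := h
  exact LexLT.append_left p (List.Lex.rel h)

theorem LexDiff.not_prefix {α : Type*} [PartialOrder α] {s t : List α} (h : LexDiff s t) :
    ¬ s <+: t ∧ ¬ t <+: s := by
  obtain ⟨p, b, c, s', t', rfl, rfl, h⟩ := h
  simp [h.ne, h.ne']

end ListLex

/-! ### Saturated chains and roots -/

section Chains

variable {P : Type u} [PartialOrder P]

theorem IsSatChain.exists_eq_cons {x y : P} {c : List P} (h : IsSatChain x y c) :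
    ∃ s, c = x :: s := by
  cases c with
  | nil => simp [IsSatChain] at h
  | cons a s =>
    obtain rfl : a = x := by simpa using h.2.1
    exact ⟨s, rfl⟩

@[simp] theorem isSatChain_singleton {x y a : P} : IsSatChain x y [a] ↔ a = x ∧ a = y := by
  simp [IsSatChain]

@[simp] theorem isSatChain_cons_cons {x y a b : P} {s : List P} :
    IsSatChain x y (a :: b :: s) ↔ a = x ∧ a ⋖ b ∧ IsSatChain b y (b :: s) := by
  simp [IsSatChain, List.isChain_cons_cons, List.getLast?_cons_cons]
  tauto

theorem IsSatChain.le {x y : P} {c : List P} (h : IsSatChain x y c) : x ≤ y := by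
  induction c generalizing x with
  | nil => simp [IsSatChain] at h
  | cons a s ih =>
    cases s with
    | nil => rw [isSatChain_singleton] at h; exact (h.1.symm.trans h.2).le
    | cons b s =>
      rw [isSatChain_cons_cons] at h
      obtain ⟨rfl, hab, h⟩ := h
      exact hab.le.trans (ih h)

theorem IsSatChain.append {x y z : P} {s e : List P} (h : IsSatChain x y (x :: s))
    (he : IsSatChain y z (y :: e)) : IsSatChain x z (x :: (s ++ e)) := by
  induction s generalizing x with
  | nil =>
    obtain rfl : x = y := by simpa using h
    exact he
  | cons a s ih =>
    rw [isSatChain_cons_cons] at h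
    rw [List.cons_append, isSatChain_cons_cons]
    exact ⟨rfl, h.2.1, ih h.2.2⟩

theorem IsSatChain.eq_nil {x : P} {s : List P} (h : IsSatChain x x (x :: s)) : s = [] := by
  cases s with
  | nil => rfl
  | cons a s =>
    rw [isSatChain_cons_cons] at h
    exact absurd h.2.2.le h.2.1.lt.not_ge

theorem IsSatChain.eq_of_covBy {x y : P} {s : List P} (hxy : x ⋖ y)
    (h : IsSatChain x y (x :: s)) : s = [y] := by
  cases s with
  | nil => simp at h; exact absurd h hxy.ne
  | cons a s =>
    rw [isSatChain_cons_cons] at h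
    obtain rfl : a = y := by
      by_contra hne
      exact hxy.2 h.2.1.lt (lt_of_le_of_ne h.2.2.le hne)
    rw [h.2.2.eq_nil]

theorem IsSatChain.exists_of_lt {x y : P} {s : List P} (hxy : x < y)
    (h : IsSatChain x y (x :: s)) :
    ∃ a s', s = a :: s' ∧ x ⋖ a ∧ a ≤ y ∧ IsSatChain a y (a :: s') := by
  cases s with
  | nil => simp at h; exact absurd h hxy.ne
  | cons a s =>
    rw [isSatChain_cons_cons] at h
    exact ⟨a, s, rfl, h.2.1, h.2.2.le, h.2.2⟩

theorem isSatChain_pair {x a : P} (h : x ⋖ a) : IsSatChain x a [x, a] := by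
  simp [h]

theorem isSatChain_triple {x a b : P} (h : x ⋖ a) (h' : a ⋖ b) : IsSatChain x b [x, a, b] := by
  simp [h, h']

theorem exists_isSatChain [Finite P] {x y : P} (h : x ≤ y) :
    ∃ s, IsSatChain x y (x :: s) := by
  induction x using WellFoundedGT.induction with
  | ind x ih =>
    rcases h.eq_or_lt with rfl | hlt
    · exact ⟨[], by simp⟩
    · obtain ⟨a, ha, hay⟩ := exists_covBy_le_of_lt hlt
      obtain ⟨s, hs⟩ := ih a ha.lt hay
      exact ⟨a :: s, by rw [isSatChain_cons_cons]; exact ⟨rfl, ha, hs⟩⟩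

section Root

variable [OrderBot P]

theorem IsRoot.append {x y : P} {r s : List P} (hr : IsRoot r x)
    (h : IsSatChain x y (x :: s)) : IsRoot (r ++ s) y := by
  obtain ⟨r', rfl⟩ := IsSatChain.exists_eq_cons hr
  exact IsSatChain.append hr h

theorem IsRoot.snoc {x y : P} {r : List P} (hr : IsRoot r x) (h : x ⋖ y) :
    IsRoot (r ++ [y]) y :=
  hr.append (isSatChain_pair h)

/-- The part of a saturated chain that follows a root. -/
theorem IsRoot.of_append {x y : P} {r e : List P} (hr : IsRoot r x) (h : IsRoot (r ++ e) y) :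
    IsSatChain x y (x :: e) := by
  obtain ⟨r, rfl⟩ := IsSatChain.exists_eq_cons hr
  have key : ∀ (w : P) (r : List P), IsSatChain w x (w :: r) → IsSatChain w y (w :: (r ++ e)) →
      IsSatChain x y (x :: e) := by
    intro w r
    induction r generalizing w with
    | nil =>
      intro h₁ h₂
      obtain rfl : w = x := by simpa using h₁
      exact h₂
    | cons a r ih =>
      intro h₁ h₂
      rw [isSatChain_cons_cons] at h₁
      rw [List.cons_append, isSatChain_cons_cons] at h₂
      exact ih a h₁.2.2 h₂.2.2
  exact key _ _ hr h

end Root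

end Chains

/-! ### Label sequences of concatenated chains -/

section LabelSeq

variable {P : Type u} {Λ : Type v} (lab : CELabeling P Λ)

@[simp] theorem labelSeq_singleton (r : List P) (x : P) : labelSeq lab r [x] = [] := rfl

@[simp] theorem labelSeq_cons_cons (r : List P) (x a : P) (s : List P) :
    labelSeq lab r (x :: a :: s) = lab r x a :: labelSeq lab (r ++ [a]) (a :: s) := rfl

theorem labelSeq_append [PartialOrder P] {x y : P} (r s e : List P) (h : IsSatChain x y (x :: s)) :
    labelSeq lab r (x :: (s ++ e)) =
      labelSeq lab r (x :: s) ++ labelSeq lab (r ++ s) (y :: e) := by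
  induction s generalizing x r with
  | nil =>
    obtain rfl : x = y := by simpa using h
    simp
  | cons a s ih =>
    rw [isSatChain_cons_cons] at h
    simp [ih (r ++ [a]) h.2.2]

theorem labelSeq_root_append [PartialOrder P] [OrderBot P] {x : P} {r : List P} (hr : IsRoot r x)
    (e : List P) :
    labelSeq lab [⊥] (r ++ e) = labelSeq lab [⊥] r ++ labelSeq lab r (x :: e) := by
  obtain ⟨r, rfl⟩ := IsSatChain.exists_eq_cons hr
  exact labelSeq_append lab [⊥] r e hr

theorem length_labelSeq (r s : List P) (x : P) : (labelSeq lab r (x :: s)).length = s.length := by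
  induction s generalizing x r with
  | nil => simp
  | cons a s ih => simp [ih]

end LabelSeq

/-! ### The first atom set of a TCL-labeling -/

section AscendingChain

variable {P : Type u} [PartialOrder P] {Λ : Type v} [PartialOrder Λ]

/-- A topologically ascending maximal chain of `[x, y]_r`, if there is one. -/
noncomputable def ascChain (lab : CELabeling P Λ) (r : List P) (x y : P) : List P :=
  Classical.epsilon fun c => IsSatChain x y c ∧ IsTopAscending lab r c

/-- The first atom of `[x, y]_r` determined by a labeling: the atom on its topologically ascending
chain. -/
noncomputable def ascAtom (lab : CELabeling P Λ) (r : List P) (x y : P) : P :=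
  (ascChain lab r x y).tail.headD x

variable [OrderBot P] {lab : CELabeling P Λ} {r : List P} {x y a b : P}

namespace IsTCLLabeling

variable (h : IsTCLLabeling lab)

include h

theorem ascChain_spec (hr : IsRoot r x) (hxy : x ≤ y) :
    IsSatChain x y (ascChain lab r x y) ∧ IsTopAscending lab r (ascChain lab r x y) := by
  obtain ⟨c, hc, hc', -⟩ := h r x y hr hxy
  exact Classical.epsilon_spec (p := fun c => IsSatChain x y c ∧ IsTopAscending lab r c)
    ⟨c, hc, hc'⟩

theorem eq_ascChain (hr : IsRoot r x) {c : List P} (hc : IsSatChain x y c)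
    (hc' : IsTopAscending lab r c) : c = ascChain lab r x y := by
  obtain ⟨c₀, -, -, hu, -⟩ := h r x y hr hc.le
  have hs := h.ascChain_spec hr hc.le
  rw [hu _ hc hc', hu _ hs.1 hs.2]

theorem ascChain_lexLT (hr : IsRoot r x) {c : List P} (hc : IsSatChain x y c)
    (hne : c ≠ ascChain lab r x y) :
    LexLT (labelSeq lab r (ascChain lab r x y)) (labelSeq lab r c) := by
  obtain ⟨c₀, -, -, hu, hlt⟩ := h r x y hr hc.le
  have hs := h.ascChain_spec hr hc.le
  have := hu _ hs.1 hs.2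
  rw [this] at hne ⊢
  exact hlt _ hc hne

theorem ascAtom_eq (hr : IsRoot r x) {s : List P} (hc : IsSatChain x y (x :: a :: s))
    (hc' : IsTopAscending lab r (x :: a :: s)) : ascAtom lab r x y = a := by
  rw [ascAtom, ← h.eq_ascChain hr hc hc']
  rfl

theorem exists_ascChain_eq (hr : IsRoot r x) (hxy : x < y) :
    ∃ s, ascChain lab r x y = x :: ascAtom lab r x y :: s := by
  have hs := h.ascChain_spec hr hxy.le
  obtain ⟨s, hs'⟩ := hs.1.exists_eq_cons
  obtain ⟨a, s', rfl, -⟩ := (hs' ▸ hs.1).exists_of_lt hxy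
  refine ⟨s', ?_⟩
  simp [ascAtom, hs']

theorem ascAtom_spec (hr : IsRoot r x) (hxy : x < y) :
    x ⋖ ascAtom lab r x y ∧ ascAtom lab r x y ≤ y := by
  obtain ⟨s, hs⟩ := h.exists_ascChain_eq hr hxy
  have hc := (h.ascChain_spec hr hxy.le).1
  rw [hs, isSatChain_cons_cons] at hc
  exact ⟨hc.2.1, hc.2.2.le⟩

theorem ascChain_eq_cons (hr : IsRoot r x) (hxy : x < y) :
    ascChain lab r x y =
      x :: ascChain lab (r ++ [ascAtom lab r x y]) (ascAtom lab r x y) y := by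
  obtain ⟨s, hs⟩ := h.exists_ascChain_eq hr hxy
  have hc := h.ascChain_spec hr hxy.le
  rw [hs, isSatChain_cons_cons] at hc
  rw [hs, ← h.eq_ascChain (hr.snoc hc.1.2.1) hc.1.2.2]
  cases s with
  | nil => trivial
  | cons b s => exact hc.2.2

theorem isTopAscent_iff (hr : IsRoot r x) (hxa : x ⋖ a) (hab : a ⋖ b) :
    IsTopAscent lab r x a b ↔ a = ascAtom lab r x b := by
  constructor
  · intro ht
    exact (h.ascAtom_eq hr (isSatChain_triple hxa hab) ⟨ht, trivial⟩).symm
  · intro ha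
    have hs := h.ascChain_spec hr (hxa.lt.trans hab.lt).le
    rw [h.ascChain_eq_cons hr (hxa.lt.trans hab.lt), ← ha] at hs
    have hs' := (h.ascChain_spec (hr.snoc hxa) hab.le).1
    obtain ⟨s, hs''⟩ := hs'.exists_eq_cons
    rw [hs''] at hs' hs
    rw [hs'.eq_of_covBy hab] at hs
    exact hs.2.1

/-- The ascending chain of `[a, y]`, preceded by `x`, is ascending as soon as its first piece is a
topological ascent. -/
theorem ascAtom_cond_i (hr : IsRoot r x) (hxa : x ⋖ a) (hay : a < y) :
    a = ascAtom lab r x y ↔ a = ascAtom lab r x (ascAtom lab (r ++ [a]) a y) := by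
  have hb := h.ascAtom_spec (hr.snoc hxa) hay
  rw [← h.isTopAscent_iff hr hxa hb.1]
  obtain ⟨s, hs⟩ := h.exists_ascChain_eq (hr.snoc hxa) hay
  have hc := h.ascChain_spec (hr.snoc hxa) hay.le
  constructor
  · intro ha
    have hc₀ := h.ascChain_spec hr (hxa.lt.trans hay).le
    rw [h.ascChain_eq_cons hr (hxa.lt.trans hay), ← ha, hs] at hc₀
    exact hc₀.2.1
  · intro ht
    rw [hs] at hc
    exact (h.ascAtom_eq hr (isSatChain_cons_cons.2 ⟨rfl, hxa, hc.1⟩) ⟨ht, hc.2⟩).symm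

theorem pairLT_of_ne (hr : IsRoot r x) (hxa : x ⋖ a) (hab : a ⋖ b)
    (hne : a ≠ ascAtom lab r x b) :
    ascAtom lab r x b < b ∧
    PairLT (lab r x (ascAtom lab r x b))
      (lab (r ++ [ascAtom lab r x b]) (ascAtom lab r x b)
        (ascAtom lab (r ++ [ascAtom lab r x b]) (ascAtom lab r x b) b))
      (lab r x a) (lab (r ++ [a]) a b) := by
  have hxb := hxa.lt.trans hab.lt
  have ha' := h.ascAtom_spec hr hxb
  have hlt : ascAtom lab r x b < b := by
    refine lt_of_le_of_ne ha'.2 fun he => ?_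
    rw [he] at ha'
    exact ha'.1.2 hxa.lt hab.lt
  refine ⟨hlt, ?_⟩
  obtain ⟨s, hs⟩ := h.exists_ascChain_eq (hr.snoc ha'.1) hlt
  have hl := h.ascChain_lexLT hr (isSatChain_triple hxa hab) (by
    rw [h.ascChain_eq_cons hr hxb, hs]
    intro he
    exact hne (List.cons.inj (List.cons.inj he).2).1)
  rw [h.ascChain_eq_cons hr hxb, hs] at hl
  exact pairLT_of_lexLT hl

/-- This is the descent behind condition (ii). Going through the ascending chain of `[x, b]_r`
already wins within two labels, whatever follows above `b`; the ascending continuation to `y` can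
only be better. -/
theorem lexLT_of_ne [Finite P] (hr : IsRoot r x) (hxa : x ⋖ a) (hay : a < y)
    (hb : b = ascAtom lab (r ++ [a]) a y) (hne : a ≠ ascAtom lab r x b) :
    LexLT
      (labelSeq lab r (x :: ascChain lab (r ++ [ascAtom lab r x b]) (ascAtom lab r x b) y))
      (labelSeq lab r (x :: ascChain lab (r ++ [a]) a y)) := by
  have hab := h.ascAtom_spec (hr.snoc hxa) hay
  rw [← hb] at hab
  have hxb := hxa.lt.trans hab.1.lt
  obtain ⟨hlt, hp⟩ := h.pairLT_of_ne hr hxa hab.1 hne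
  have ha' := h.ascAtom_spec hr hxb
  obtain ⟨s, hs⟩ := h.exists_ascChain_eq (hr.snoc hxa) hay
  obtain ⟨s', hs'⟩ := h.exists_ascChain_eq (hr.snoc ha'.1) hlt
  obtain ⟨e, he⟩ := exists_isSatChain hab.2
  have hc := (h.ascChain_spec (hr.snoc ha'.1) hlt.le).1
  rw [hs'] at hc
  have hce := hc.append he
  rw [hs, ← hb]
  have hl : LexLT (labelSeq lab r (x :: ascAtom lab r x b ::
      (ascAtom lab (r ++ [ascAtom lab r x b]) (ascAtom lab r x b) b :: s' ++ e)))
      (labelSeq lab r (x :: a :: b :: s)) := hp.lexLT _ _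
  by_cases heq : ascAtom lab r x b ::
      (ascAtom lab (r ++ [ascAtom lab r x b]) (ascAtom lab r x b) b :: s' ++ e) =
      ascChain lab (r ++ [ascAtom lab r x b]) (ascAtom lab r x b) y
  · rw [← heq]
    exact hl
  · refine lexLT_trans ?_ hl
    have := h.ascChain_lexLT (hr.snoc ha'.1) hce heq
    obtain ⟨s'', hs''⟩ := h.exists_ascChain_eq (hr.snoc ha'.1) (hlt.trans_le hab.2)
    rw [hs''] at this ⊢
    rw [labelSeq_cons_cons, labelSeq_cons_cons]
    exact List.Lex.cons this

theorem isRFAS [Finite P] : IsRFAS (ascAtom lab) where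
  atom _ _ _ hr hxy := h.ascAtom_spec hr hxy
  cond_i r x y a b hr hxa hay hb := by
    subst hb
    exact h.ascAtom_cond_i hr hxa hay
  cond_ii r x y a b hr hxa hay hb hne := by
    let g : P → List Λ := fun a => labelSeq lab r (x :: ascChain lab (r ++ [a]) a y)
    let R : P → P → Prop := fun a' a => LexLT (g a') (g a)
    have : IsTrans P R := ⟨fun _ _ _ => lexLT_trans⟩
    have : Std.Irrefl R := ⟨fun _ hl => lexLT_asymm hl hl⟩
    have hwf : WellFounded R := Finite.wellFounded_of_trans_of_irrefl R
    induction a using hwf.induction generalizing b with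
    | _ a ih =>
    have hne' : a ≠ ascAtom lab r x b := by
      rw [hb]
      exact fun he => hne ((h.ascAtom_cond_i hr hxa hay).2 he)
    have hab := h.ascAtom_spec (hr.snoc hxa) hay
    rw [← hb] at hab
    have ha' := h.ascAtom_spec hr (hxa.lt.trans hab.1.lt)
    have hlt := (h.pairLT_of_ne hr hxa hab.1 hne').1
    set a' := ascAtom lab r x b with ha'def
    by_cases hfirst : a' = ascAtom lab r x y
    · exact ⟨1, fun _ => a', fun _ => a', le_rfl, fun _ _ _ => ⟨ha'.1, ha'.2.trans hab.2⟩,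
        rfl, hfirst, fun i h₁ h₂ => absurd h₂ (not_lt.2 h₁)⟩
    · obtain ⟨p, as, bs, hp, has, hlast, hone, hstep⟩ :=
        ih a' (h.lexLT_of_ne hr hxa hay hb hne') _ ha'.1 (hlt.trans_le hab.2) rfl hfirst
      -- Append `a'` to the sequence obtained for `a'`: the new `b_p` is the first atom above `a'`,
      -- and `a_{p+1} = a'` is first in `[x, b]_r`.
      refine ⟨p + 1, fun i => if i ≤ p then as i else a',
        fun i => if i < p then bs i else ascAtom lab (r ++ [a']) a' y, by omega, ?_, ?_, ?_, ?_⟩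
      · intro i h₁ h₂
        dsimp only
        split_ifs with hi
        · exact has i h₁ hi
        · exact ⟨ha'.1, ha'.2.trans hab.2⟩
      · simp
      · simp [hp, hone]
      · intro i h₁ h₂
        dsimp only
        rcases (Nat.lt_succ_iff.1 h₂).lt_or_eq with hi | rfl
        · simpa [hi, hi.le, Nat.succ_le_iff] using hstep i h₁ hi
        · simpa using hlast

end IsTCLLabeling

end AscendingChain

/-! ### Sorting maximal chains by refined labels -/

section CompatibleEnumeration

variable {P : Type u} [PartialOrder P] {Λ : Type v} [PartialOrder Λ]

theorem toLinearExtension_lt {α : Type*} [PartialOrder α] {a b : α} (h : a < b) :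
    toLinearExtension a < toLinearExtension b :=
  lt_of_le_of_ne (toLinearExtension.monotone h.le) h.ne

/-- The labeling with totally ordered labels in which ties are broken by the bottom element of the
edge. -/
noncomputable def refinedLabeling (lab : CELabeling P Λ) :
    CELabeling P (LinearExtension Λ ×ₗ LinearExtension P) :=
  fun r x u => toLex (toLinearExtension (lab r x u), toLinearExtension x)

theorem refinedLabeling_lt {lab : CELabeling P Λ} {r r' : List P} {x x' u u' : P}
    (h : lab r x u < lab r' x' u') :
    refinedLabeling lab r x u < refinedLabeling lab r' x' u' :=
  Prod.Lex.toLex_lt_toLex.2 (Or.inl (toLinearExtension_lt h))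

theorem refinedLabeling_inj {lab : CELabeling P Λ} {r r' : List P} {x x' u u' : P}
    (h : refinedLabeling lab r x u = refinedLabeling lab r' x' u') : x = x' :=
  congrArg (fun p => (ofLex p).2) h

/-- Each vertex below `y` is recorded as the bottom of the edge leaving it, and the common top is
`y`. -/
theorem eq_of_labelSeq_refinedLabeling_eq {lab : CELabeling P Λ} {r r' : List P} {x x' y : P}
    {s s' : List P} (hs : IsSatChain x y (x :: s)) (hs' : IsSatChain x' y (x' :: s'))
    (hx : x = x')
    (h : labelSeq (refinedLabeling lab) r (x :: s) =
      labelSeq (refinedLabeling lab) r' (x' :: s')) : s = s' := by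
  induction s generalizing x x' s' r r' with
  | nil =>
    have := congrArg List.length h
    rw [length_labelSeq, length_labelSeq] at this
    exact (List.length_eq_zero_iff.1 this.symm).symm
  | cons a s ih =>
    cases s' with
    | nil => simp at h
    | cons a' s' =>
      rw [labelSeq_cons_cons, labelSeq_cons_cons, List.cons.injEq] at h
      rw [isSatChain_cons_cons] at hs hs'
      have haa : a = a' := by
        cases s with
        | nil =>
          have hl := congrArg List.length h.2
          rw [length_labelSeq, length_labelSeq] at hl
          obtain rfl := List.length_eq_zero_iff.1 hl.symm
          have h₁ := hs.2.2
          have h₂ := hs'.2.2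
          simp only [isSatChain_singleton, true_and] at h₁ h₂
          rw [h₁, h₂]
        | cons b s =>
          cases s' with
          | nil => simp at h
          | cons b' s' =>
            rw [labelSeq_cons_cons, labelSeq_cons_cons, List.cons.injEq] at h
            exact refinedLabeling_inj h.2.1
      subst haa
      rw [ih hs.2.2 hs'.2.2 rfl h.2]

variable [BoundedOrder P]

/-- The refined label sequence of a maximal chain. -/
noncomputable def chainKey (lab : CELabeling P Λ) (m : MaxChain P) :
    List (LinearExtension Λ ×ₗ LinearExtension P) :=
  labelSeq (refinedLabeling lab) [⊥] m.1

theorem chainKey_injective (lab : CELabeling P Λ) : Function.Injective (chainKey lab) := by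
  rintro ⟨m, hm⟩ ⟨m', hm'⟩ h
  obtain ⟨s, rfl⟩ := hm.exists_eq_cons
  obtain ⟨s', rfl⟩ := hm'.exists_eq_cons
  have := eq_of_labelSeq_refinedLabeling_eq hm hm' rfl h
  subst this
  rfl

instance [Finite P] : Finite (MaxChain P) := by
  classical
  have := Fintype.ofFinite P
  refine Finite.of_injective
    (fun m : MaxChain P => (⟨m.1, ?_⟩ : {l : List P // l.Nodup})) ?_
  · have h : m.1.IsChain (· < ·) := m.2.1.imp fun _ _ h => h.lt
    exact (List.isChain_iff_pairwise.1 h).imp fun h => h.ne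
  · intro m m' h
    exact Subtype.ext (congrArg (fun l : {l : List P // l.Nodup} => l.1) h)

variable {lab : CELabeling P Λ}

theorem IsTCLLabeling.chainKey_lt_of_arrow (h : IsTCLLabeling lab) {m m' : MaxChain P}
    (hm : Arrow (ascAtom lab) m m') : chainKey lab m < chainKey lab m' := by
  obtain ⟨r, c, d, x, y, z, hr, ⟨hxy, hyz, hne⟩, hm', ⟨hc, hf⟩, hm⟩ := hm
  obtain ⟨s, rfl⟩ := hc.exists_eq_cons
  obtain ⟨a, s, rfl, hxa, haz, hc'⟩ := hc.exists_of_lt (hxy.lt.trans hyz.lt)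
  obtain ⟨hlt, hp⟩ := h.pairLT_of_ne hr hxy hyz hne
  have ha := hf.1
  rw [← ha] at hlt hp
  obtain ⟨b, s, rfl, -⟩ := hc'.exists_of_lt hlt
  rw [← hf.2.1] at hp
  rw [chainKey, chainKey, hm, hm', List.append_assoc, List.append_assoc,
    labelSeq_root_append _ hr, labelSeq_root_append _ hr]
  refine LexLT.append_left _ (PairLT.lexLT ?_ _ _)
  rcases hp with hp | hp
  · exact Or.inl (refinedLabeling_lt hp)
  -- A tie of first labels survives refinement because both edges start at `x`.
  · refine Or.inr ⟨?_, refinedLabeling_lt hp.2⟩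
    simp [refinedLabeling, hp.1]

/-- A list between two lists with a common prefix has the same prefix. -/
theorem eq_of_append_lt_append {α : Type*} [PartialOrder α] {p q s t w : List α}
    (hl : p.length = q.length) (h₁ : LexLT (p ++ s) (q ++ t)) (h₂ : LexLT (q ++ t) (p ++ w)) :
    p = q := by
  rcases LexLT.of_append hl h₁ with h | h
  · exact h
  · rcases LexLT.of_append hl.symm h₂ with h' | h'
    · exact h'.symm
    · exact absurd h (lexLT_asymm h')

theorem IsTCLLabeling.satisfiesLC [Finite P] (h : IsTCLLabeling lab) :
    SatisfiesLC (ascAtom lab) := by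
  classical
  let : LinearOrder (MaxChain P) := LinearOrder.lift' (chainKey lab) (chainKey_injective lab)
  have := Fintype.ofFinite (MaxChain P)
  let Γ := Fintype.orderIsoFinOfCardEq (MaxChain P) rfl
  have hΓ : ∀ i j, i < j ↔ chainKey lab (Γ i) < chainKey lab (Γ j) := fun i j =>
    (Γ.lt_iff_lt (x := i) (y := j)).symm
  refine ⟨_, Γ.toEquiv, ?_, ?_⟩
  · intro i j hij
    rw [← Γ.le_iff_le]
    change ChainLE _ (Γ i) (Γ j) at hij
    generalize Γ i = m at hij
    generalize Γ j = m' at hij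
    induction hij with
    | refl => exact le_rfl
    | tail _ hm ih => exact ih.trans (le_of_lt (h.chainKey_lt_of_arrow hm))
  · intro i j k hij hjk r x y y' z hr hxy hyz hxy' hi hk hj
    rw [hΓ] at hij hjk
    obtain ⟨d, hd⟩ := hi
    obtain ⟨d', hd'⟩ := hk
    obtain ⟨e, he⟩ := hj
    have hy' := hr.snoc hxy'
    have hsat : IsSatChain y' ⊤ (y' :: e) := hy'.of_append (by rw [he]; exact (Γ j).2)
    -- The edge leaving `y'` must exist, since it is its label that reveals `y'`.
    have hlt : y' < ⊤ := by
      refine lt_of_le_of_ne le_top fun htop => ?_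
      subst htop
      exact hxy'.2 hxy.lt (hyz.lt.trans_le le_top)
    obtain ⟨z', e, rfl, -⟩ := hsat.exists_of_lt hlt
    have he' : r ++ [y', z'] ++ e = (Γ j).1 := Eq.trans (by simp) he
    have key : ∀ (m : MaxChain P) (v w : P) (f : List P), r ++ [v, w] ++ f = m.1 →
        chainKey lab m = (labelSeq (refinedLabeling lab) [⊥] r ++
          [refinedLabeling lab r x v, refinedLabeling lab (r ++ [v]) v w]) ++
          labelSeq (refinedLabeling lab) (r ++ [v] ++ [w]) (w :: f) := by
      intro m v w f hm
      rw [chainKey, ← hm, List.append_assoc, labelSeq_root_append _ hr]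
      simp
    rw [key (Γ i) y z d hd, key (Γ j) y' z' e he'] at hij
    rw [key (Γ k) y z d' hd', key (Γ j) y' z' e he'] at hjk
    have := List.append_cancel_left (eq_of_append_lt_append (by simp) hij hjk)
    simp only [List.cons.injEq] at this
    exact (refinedLabeling_inj this.2.1).symm

theorem IsTCLLabeling.admitsLCRFAS [Finite P] (h : IsTCLLabeling lab) : AdmitsLCRFAS P :=
  ⟨_, h.isRFAS, h.satisfiesLC⟩

end CompatibleEnumeration

/-! ### First atom chains and pseudo descents -/

section FirstAtomChains

variable {P : Type u} [PartialOrder P] {Ω : List P → P → P → P}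

theorem FollowsFirstAtoms.eq {x y : P} {r s s' : List P} (hs : IsSatChain x y (x :: s))
    (hs' : IsSatChain x y (x :: s')) (h : FollowsFirstAtoms Ω y r (x :: s))
    (h' : FollowsFirstAtoms Ω y r (x :: s')) : s = s' := by
  induction s generalizing x r s' with
  | nil =>
    obtain rfl : x = y := by simpa using hs
    exact hs'.eq_nil.symm
  | cons a s ih =>
    rw [isSatChain_cons_cons] at hs
    obtain ⟨a', s', rfl, -⟩ := hs'.exists_of_lt (hs.2.1.lt.trans_le hs.2.2.le)
    rw [isSatChain_cons_cons] at hs'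
    obtain rfl : a = a' := h.1.trans h'.1.symm
    rw [ih hs.2.2 hs'.2.2 h.2 h'.2]

variable [OrderBot P]

theorem IsRFAS.eq_of_covBy (hΩ : IsRFAS Ω) {r : List P} {x y : P} (hr : IsRoot r x)
    (hxy : x ⋖ y) : Ω r x y = y := by
  have h := hΩ.atom r x y hr hxy.lt
  by_contra hne
  exact hxy.2 h.1.lt (lt_of_le_of_ne h.2 hne)

theorem IsRFAS.exists_isFirstAtomChain [Finite P] (hΩ : IsRFAS Ω) {r : List P} {x y : P}
    (hr : IsRoot r x) (hxy : x ≤ y) : ∃ s, IsFirstAtomChain Ω r x y (x :: s) := by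
  induction x using WellFoundedGT.induction generalizing r with
  | ind x ih =>
    rcases hxy.eq_or_lt with rfl | hlt
    · exact ⟨[], by simp, trivial⟩
    · obtain ⟨ha, hay⟩ := hΩ.atom r x y hr hlt
      obtain ⟨s, hs, hs'⟩ := ih _ ha.lt (hr.snoc ha) hay
      exact ⟨Ω r x y :: s, isSatChain_cons_cons.2 ⟨rfl, ha, hs⟩, rfl, hs'⟩

/-- A first step `x ⋖ a ⋖ b` of a chain whose part from `a` on is a first atom chain. -/
theorem IsRFAS.followsFirstAtoms_cons_iff (hΩ : IsRFAS Ω) {r s : List P} {x y a b : P}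
    (hr : IsRoot r x) (hs : IsSatChain x y (x :: a :: b :: s)) :
    FollowsFirstAtoms Ω y r (x :: a :: b :: s) ↔
      a = Ω r x b ∧ FollowsFirstAtoms Ω y (r ++ [a]) (a :: b :: s) := by
  simp only [isSatChain_cons_cons, true_and] at hs
  obtain ⟨hxa, hab, hs⟩ := hs
  refine and_congr_left fun hf => ?_
  exact hΩ.cond_i r x y a b hr hxa (hab.lt.trans_le hs.le) hf.1

/-- A saturated chain is a first atom chain, or it contains a pseudo descent. -/
theorem IsRFAS.followsFirstAtoms_or_exists (hΩ : IsRFAS Ω) {r l : List P} {x y : P}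
    (hr : IsRoot r x) (hl : IsSatChain x y (x :: l)) :
    FollowsFirstAtoms Ω y r (x :: l) ∨
      ∃ (s e : List P) (u v w : P), l = s ++ [v, w] ++ e ∧ IsSatChain x u (x :: s) ∧
        IsSatChain w y (w :: e) ∧ IsPseudoDescent Ω (r ++ s) u v w := by
  induction l generalizing r x with
  | nil => exact Or.inl trivial
  | cons a l ih =>
    have hl' := hl
    rw [isSatChain_cons_cons] at hl
    obtain ⟨-, hxa, hl⟩ := hl
    rcases ih (hr.snoc hxa) hl with hf | ⟨s, e, u, v, w, rfl, hs, he, hd⟩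
    · cases l with
      | nil =>
        obtain rfl : a = y := by simpa using hl
        exact Or.inl ⟨(hΩ.eq_of_covBy hr hxa).symm, trivial⟩
      | cons b l =>
        by_cases hab : a = Ω r x b
        · exact Or.inl ((hΩ.followsFirstAtoms_cons_iff hr hl').2 ⟨hab, hf⟩)
        · rw [isSatChain_cons_cons] at hl
          exact Or.inr ⟨[], l, x, a, b, rfl, by simp, hl.2.2, hxa, hl.2.1, by simpa using hab⟩
    · refine Or.inr ⟨a :: s, e, u, v, w, rfl, isSatChain_cons_cons.2 ⟨rfl, hxa, hs⟩, he, ?_⟩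
      simpa using hd

end FirstAtomChains

/-! ### Labeling edges by cuts of an enumeration -/

section CutLabeling

theorem eq_of_prefix_snoc {α : Type*} {r l : List α} {y y' : α} (h : r ++ [y] <+: l)
    (h' : r ++ [y'] <+: l) : y = y' := by
  have := (List.prefix_of_prefix_length_le h h' (by simp)).eq_of_length (by simp)
  simpa using this

theorem prefix_of_prefix_snoc {α : Type*} {r l : List α} {y z : α} (h : r ++ [y, z] <+: l) :
    r ++ [y] <+: l :=
  List.IsPrefix.trans ⟨[z], by simp⟩ h

variable {P : Type u} [PartialOrder P] [BoundedOrder P] {t : ℕ} (Γ : Fin t ≃ MaxChain P)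

/-- `c` separates, for each `y`, the chains with initial segment `r ∪ {y}`: either all of them
come before position `c` or none does. -/
def IsCut (r : List P) (c : ℕ) : Prop :=
  ∀ (y : P) (i k : Fin t), r ++ [y] <+: (Γ i).1 → r ++ [y] <+: (Γ k).1 → i.1 < c → k.1 < c

/-- `c` is a cut for `r` that does not come after any chain with initial segment `r ∪ {y}`. -/
def IsCutBelow (r : List P) (y : P) (c : ℕ) : Prop :=
  IsCut Γ r c ∧ ∀ i : Fin t, r ++ [y] <+: (Γ i).1 → c ≤ i.1

open Classical in
/-- The last cut for `r` that does not come after any chain with initial segment `r ∪ {y}`. -/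
noncomputable def cutLabel (r : List P) (y : P) : ℕ :=
  Nat.findGreatest (IsCutBelow Γ r y) t

theorem isCutBelow_cutLabel (r : List P) (y : P) : IsCutBelow Γ r y (cutLabel Γ r y) := by
  classical
  unfold cutLabel
  -- Position `0` always qualifies, so the search succeeds.
  exact Nat.findGreatest_spec (P := IsCutBelow Γ r y) (Nat.zero_le t)
    ⟨fun _ _ _ _ _ h => absurd h (Nat.not_lt_zero _), fun _ _ => Nat.zero_le _⟩

variable {Γ}

theorem IsCutBelow.le_cutLabel {r : List P} {y : P} {c : ℕ} (h : IsCutBelow Γ r y c)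
    (hc : c ≤ t) : c ≤ cutLabel Γ r y := by
  classical
  exact Nat.le_findGreatest hc h

/-- The label of `r ∪ {y}` is the position of a chain with initial segment `r`. -/
theorem exists_prefix_cutLabel {r : List P} {y : P} {i : Fin t} (hi : r ++ [y] <+: (Γ i).1) :
    ∃ j : Fin t, j.1 = cutLabel Γ r y ∧ r <+: (Γ j).1 := by
  have hs := isCutBelow_cutLabel Γ r y
  have hlt : cutLabel Γ r y < t := (hs.2 i hi).trans_lt i.2
  by_contra! hno
  have hne : ∀ (w : P) (j : Fin t), r ++ [w] <+: (Γ j).1 → j.1 ≠ cutLabel Γ r y :=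
    fun w j hj he => hno j he ((List.prefix_append r [w]).trans hj)
  -- If the chain at the cut does not pass through `r`, moving the cut past it separates the same
  -- families, against maximality.
  have : IsCutBelow Γ r y (cutLabel Γ r y + 1) := by
    refine ⟨fun w j k hj hk hlt => ?_, fun j hj => ?_⟩
    · have := hs.1 w j k hj hk (by have := hne w j hj; omega)
      omega
    · have := hs.2 j hj
      have := hne y j hj
      omega
  have := this.le_cutLabel hlt
  omega

/-- The condition (LC) for the enumeration `Γ`. -/
def IsLabelingCompatible (Γ : Fin t ≃ MaxChain P) : Prop :=
  ∀ i j k : Fin t, i < j → j < k →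
    ∀ (r : List P) (x y y' z : P), IsRoot r x → x ⋖ y → y ⋖ z → x ⋖ y' →
      r ++ [y, z] <+: (Γ i).1 → r ++ [y, z] <+: (Γ k).1 → r ++ [y'] <+: (Γ j).1 → y' = y

variable (hLC : IsLabelingCompatible Γ) {r : List P} {x y y' z z' : P} {i j : Fin t}

theorem covBy_of_prefix (hr : IsRoot r x) (h : r ++ [y, z] <+: (Γ i).1) : x ⋖ y ∧ y ⋖ z := by
  obtain ⟨d, hd⟩ := h
  have : IsSatChain x ⊤ (x :: ([y, z] ++ d)) :=
    hr.of_append (by rw [← List.append_assoc, hd]; exact (Γ i).2)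
  simp only [List.cons_append, List.nil_append, isSatChain_cons_cons] at this
  exact ⟨this.2.1, this.2.2.2.1⟩

/-- The cut for `y` also serves `y'`: a chain through `r ∪ {y'}` before it would force `j` before
it, yet it is at most `i < j`. -/
theorem cutLabel_le_cutLabel (hi : r ++ [y] <+: (Γ i).1)
    (hj : r ++ [y'] <+: (Γ j).1) (hij : i < j) : cutLabel Γ r y ≤ cutLabel Γ r y' := by
  have hs := isCutBelow_cutLabel Γ r y
  refine IsCutBelow.le_cutLabel ⟨hs.1, fun k hk => ?_⟩ ((hs.2 i hi).trans i.2.le)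
  by_contra! hlt
  have h₁ := hs.1 y' k j hk hj hlt
  have h₂ := hs.2 i hi
  have : i.1 < j.1 := hij
  omega

include hLC

/-- The two labels are positions of chains through `y` and through `y'`, hence distinct. -/
theorem cutLabel_lt_cutLabel (hr : IsRoot r x) (hne : y ≠ y') (hi : r ++ [y, z] <+: (Γ i).1)
    (hj : r ++ [y', z'] <+: (Γ j).1) (hij : i < j) :
    cutLabel Γ (r ++ [y]) z < cutLabel Γ (r ++ [y']) z' := by
  obtain ⟨hxy, hyz⟩ := covBy_of_prefix hr hi
  obtain ⟨hxy', hyz'⟩ := covBy_of_prefix hr hj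
  have hi' : (r ++ [y]) ++ [z] <+: (Γ i).1 := by simpa using hi
  have hj' : (r ++ [y']) ++ [z'] <+: (Γ j).1 := by simpa using hj
  obtain ⟨c, hc, hcr⟩ := exists_prefix_cutLabel hi'
  obtain ⟨c', hc', hcr'⟩ := exists_prefix_cutLabel hj'
  have hcc : c ≠ c' := by
    rintro rfl
    exact hne (eq_of_prefix_snoc hcr hcr')
  have hcc' : c.1 ≠ c'.1 := fun h => hcc (Fin.ext h)
  have hci : c.1 ≤ i.1 := hc ▸ (isCutBelow_cutLabel Γ (r ++ [y]) z).2 i hi'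
  have hij' : i.1 < j.1 := hij
  by_contra! hle
  -- The chain at `c` passes through `y`, so by (LC) no family through `r ∪ {y', w}` straddles it.
  have hbelow : IsCutBelow Γ (r ++ [y']) z' c := by
    have key : ∀ (w : P) (k l : Fin t), (r ++ [y']) ++ [w] <+: (Γ k).1 →
        (r ++ [y']) ++ [w] <+: (Γ l).1 → k.1 < c.1 → l.1 < c.1 := by
      intro w k l hk hl hkc
      by_contra! hcl
      have hlc : c ≠ l := by
        rintro rfl
        exact hne (eq_of_prefix_snoc hcr ((List.prefix_append _ _).trans hl))
      have hk' : r ++ [y', w] <+: (Γ k).1 := by simpa using hk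
      exact hne (hLC k c l hkc (lt_of_le_of_ne hcl hlc) r x y' y w hr hxy'
        (covBy_of_prefix hr hk').2 hxy hk' (by simpa using hl) hcr)
    refine ⟨key, fun k hk => ?_⟩
    by_contra! hkc
    have := key z' k j hk hj' hkc
    omega
  have := hbelow.le_cutLabel c.2.le
  omega

theorem pairLT_cutLabel (hr : IsRoot r x) (hne : y ≠ y') (hi : r ++ [y, z] <+: (Γ i).1)
    (hj : r ++ [y', z'] <+: (Γ j).1) (hij : i < j) :
    PairLT (cutLabel Γ r y) (cutLabel Γ (r ++ [y]) z) (cutLabel Γ r y')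
      (cutLabel Γ (r ++ [y']) z') := by
  rcases (cutLabel_le_cutLabel (prefix_of_prefix_snoc hi) (prefix_of_prefix_snoc hj)
    hij).lt_or_eq with h | h
  · exact Or.inl h
  · exact Or.inr ⟨h, cutLabel_lt_cutLabel hLC hr hne hi hj hij⟩

omit hLC

/-- The labeling by cuts. -/
noncomputable def cutLabeling (Γ : Fin t ≃ MaxChain P) : CELabeling P (ULift.{v} ℕ) :=
  fun r _ y => ULift.up (cutLabel Γ r y)

/-- The order of the label sequences is the order of the enumeration. -/
theorem lexDiff_labelSeq (hLC : IsLabelingCompatible Γ) {r s s' d : List P} {x y : P}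
    {i j : Fin t} (hr : IsRoot r x) (hs : IsSatChain x y (x :: s))
    (hs' : IsSatChain x y (x :: s')) (hi : (Γ i).1 = r ++ s ++ d) (hj : (Γ j).1 = r ++ s' ++ d)
    (hij : i < j) :
    LexDiff (labelSeq (cutLabeling.{u, v} Γ) r (x :: s))
      (labelSeq (cutLabeling.{u, v} Γ) r (x :: s')) := by
  induction s generalizing x r s' with
  | nil =>
    obtain rfl : x = y := by simpa using hs
    obtain rfl := hs'.eq_nil
    exact absurd (Γ.injective (Subtype.ext (hi.trans hj.symm))) hij.ne
  | cons a s ih =>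
    rw [isSatChain_cons_cons] at hs
    obtain ⟨a', s', rfl, -⟩ := hs'.exists_of_lt (hs.2.1.lt.trans_le hs.2.2.le)
    rw [isSatChain_cons_cons] at hs'
    rw [labelSeq_cons_cons, labelSeq_cons_cons]
    by_cases haa : a = a'
    · subst haa
      exact (ih (hr.snoc hs.2.1) hs.2.2 hs'.2.2 (by simpa using hi) (by simpa using hj)).cons _
    -- Two distinct atoms exist, so neither is `y` and both chains have a second label to compare.
    · have hay : a < y := by
        refine lt_of_le_of_ne hs.2.2.le fun he => haa ?_
        subst he
        exact (hs.2.1.2 hs'.2.1.lt (lt_of_le_of_ne hs'.2.2.le (Ne.symm haa))).elim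
      have hay' : a' < y := by
        refine lt_of_le_of_ne hs'.2.2.le fun he => haa ?_
        subst he
        exact (hs'.2.1.2 hs.2.1.lt (lt_of_le_of_ne hs.2.2.le haa)).elim
      obtain ⟨b, s, rfl, -⟩ := hs.2.2.exists_of_lt hay
      obtain ⟨b', s', rfl, -⟩ := hs'.2.2.exists_of_lt hay'
      refine PairLT.lexDiff ?_ _ _
      exact Or.imp id (And.imp_left (congrArg ULift.up)) (pairLT_cutLabel hLC (z := b) (z' := b')
        hr haa ⟨s ++ d, by simp [hi]⟩ ⟨s' ++ d, by simp [hj]⟩ hij)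

end CutLabeling

/-! ### The cut labeling is a CC-labeling -/

section CutLabelingIsCC

variable {P : Type u} [PartialOrder P] [BoundedOrder P] {t : ℕ} {Γ : Fin t ≃ MaxChain P}
  {Ω : List P → P → P → P}

/-- The position of the maximal chain that extends a rooted saturated chain by a saturated chain
up to `⊤`. -/
theorem exists_index (Γ : Fin t ≃ MaxChain P) {r s d : List P} {x y : P} (hr : IsRoot r x)
    (hs : IsSatChain x y (x :: s)) (hd : IsSatChain y ⊤ (y :: d)) :
    ∃ i, (Γ i).1 = r ++ s ++ d :=
  ⟨Γ.symm ⟨r ++ s ++ d, (hr.append hs).append hd⟩, congrArg Subtype.val (Γ.apply_symm_apply _)⟩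

/-- The first atom chain comes before all other chains of a rooted interval. -/
theorem IsRFAS.eq_or_lt_index [Finite P] (hΩ : IsRFAS Ω) (hΓ : IsLinearExtension Ω Γ)
    {r s₀ s d : List P} {x y : P} {i₀ i : Fin t} (hr : IsRoot r x)
    (hs₀ : IsFirstAtomChain Ω r x y (x :: s₀)) (hs : IsSatChain x y (x :: s))
    (hd : IsSatChain y ⊤ (y :: d)) (hi₀ : (Γ i₀).1 = r ++ s₀ ++ d)
    (hi : (Γ i).1 = r ++ s ++ d) : s = s₀ ∨ i₀ < i := by
  induction i using WellFoundedLT.induction generalizing s with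
  | ind i ih =>
    rcases hΩ.followsFirstAtoms_or_exists hr hs with hf | ⟨p, e, u, v, w, rfl, hp, he, hdesc⟩
    · exact Or.inl (hf.eq hs hs₀.1 hs₀.2)
    · right
      have hr' := hr.append hp
      have huw := hdesc.1.lt.trans hdesc.2.1.lt
      obtain ⟨q, hq⟩ := hΩ.exists_isFirstAtomChain hr' huw.le
      have hnew : IsSatChain x y (x :: (p ++ q ++ e)) := (hp.append hq.1).append he
      obtain ⟨k, hk⟩ := exists_index Γ hr hnew hd
      have harrow : Arrow Ω (Γ k) (Γ i) :=
        ⟨r ++ p, u :: q, e ++ d, u, v, w, hr', hdesc, by simp [hi], hq, by simp [hk]⟩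
      -- The replacement changes the chain, since the first atom chain does not pass through `v`.
      have hki : k < i := by
        refine lt_of_le_of_ne (hΓ k i (Relation.ReflTransGen.single harrow)) ?_
        rintro rfl
        rw [hi] at hk
        have hq' : q = [v, w] := by
          simpa [← List.append_assoc, eq_comm] using hk
        subst hq'
        exact hdesc.2.2 hq.2.1
      rcases ih k hki hnew hk with h | h
      · rw [← h, ← hk] at hi₀
        rw [Γ.injective (Subtype.ext hi₀)]
        exact hki
      · exact h.trans hki

variable [Finite P] (hΩ : IsRFAS Ω) (hΓ : IsLinearExtension Ω Γ) (hLC : IsLabelingCompatible Γ)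

include hΩ hΓ hLC

theorem IsRFAS.labelSeq_lexLT {r s₀ s : List P} {x y : P} (hr : IsRoot r x)
    (hs₀ : IsFirstAtomChain Ω r x y (x :: s₀)) (hs : IsSatChain x y (x :: s)) (hne : s ≠ s₀) :
    LexLT (labelSeq (cutLabeling.{u, v} Γ) r (x :: s₀))
      (labelSeq (cutLabeling.{u, v} Γ) r (x :: s)) := by
  obtain ⟨d, hd⟩ := exists_isSatChain (le_top (a := y))
  obtain ⟨i₀, hi₀⟩ := exists_index Γ hr hs₀.1 hd
  obtain ⟨i, hi⟩ := exists_index Γ hr hs hd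
  exact (lexDiff_labelSeq hLC hr hs₀.1 hs hi₀ hi
    ((hΩ.eq_or_lt_index hΓ hr hs₀ hs hd hi₀ hi).resolve_left hne)).lexLT

/-- Both sides say that `x ⋖ a ⋖ b` is the first atom chain, the strict lexicographic minimum of
`[x, b]_r`. -/
theorem IsRFAS.isTopAscent_cutLabeling_iff {r : List P} {x a b : P} (hr : IsRoot r x)
    (hxa : x ⋖ a) (hab : a ⋖ b) :
    IsTopAscent (cutLabeling.{u, v} Γ) r x a b ↔ a = Ω r x b := by
  obtain ⟨s₀, hs₀⟩ := hΩ.exists_isFirstAtomChain hr (hxa.lt.trans hab.lt).le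
  have htriple := isSatChain_triple hxa hab
  constructor
  · intro ht
    by_contra hne
    have hs : [a, b] ≠ s₀ := by
      rintro rfl
      exact hne hs₀.2.1
    exact lexLT_asymm (hΩ.labelSeq_lexLT hΓ hLC hr hs₀ htriple hs)
      (ht _ hs₀.1 fun h => hs (List.cons.inj h).2.symm)
  · intro ha c hc hne
    have hf : FollowsFirstAtoms Ω b r [x, a, b] :=
      ⟨ha, (hΩ.eq_of_covBy (hr.snoc hxa) hab).symm, trivial⟩
    obtain ⟨s, rfl⟩ := hc.exists_eq_cons
    exact hΩ.labelSeq_lexLT hΓ hLC hr ⟨htriple, hf⟩ hc fun h => hne (h ▸ rfl)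

theorem IsRFAS.isTopAscending_cutLabeling_iff {r s : List P} {x y : P} (hr : IsRoot r x)
    (hs : IsSatChain x y (x :: s)) :
    IsTopAscending (cutLabeling.{u, v} Γ) r (x :: s) ↔ FollowsFirstAtoms Ω y r (x :: s) := by
  induction s generalizing x r with
  | nil => exact Iff.rfl
  | cons a s ih =>
    have hs' := hs
    rw [isSatChain_cons_cons] at hs
    cases s with
    | nil =>
      obtain rfl : a = y := by simpa using hs.2.2
      exact ⟨fun _ => ⟨(hΩ.eq_of_covBy hr hs.2.1).symm, trivial⟩, fun _ => trivial⟩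
    | cons b s =>
      rw [hΩ.followsFirstAtoms_cons_iff hr hs', ← ih (hr.snoc hs.2.1) hs.2.2,
        ← hΩ.isTopAscent_cutLabeling_iff hΓ hLC hr hs.2.1 (isSatChain_cons_cons.1 hs.2.2).2.1]
      rfl

theorem IsRFAS.isCCLabeling_cutLabeling : IsCCLabeling (cutLabeling.{u, v} Γ) := by
  constructor
  · intro r x y hr hxy
    obtain ⟨s₀, hs₀⟩ := hΩ.exists_isFirstAtomChain hr hxy
    refine ⟨x :: s₀, hs₀.1, (hΩ.isTopAscending_cutLabeling_iff hΓ hLC hr hs₀.1).2 hs₀.2, ?_, ?_⟩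
    · intro c hc ht
      obtain ⟨s, rfl⟩ := hc.exists_eq_cons
      rw [((hΩ.isTopAscending_cutLabeling_iff hΓ hLC hr hc).1 ht).eq hc hs₀.1 hs₀.2]
    · intro c hc hne
      obtain ⟨s, rfl⟩ := hc.exists_eq_cons
      exact hΩ.labelSeq_lexLT hΓ hLC hr hs₀ hc fun h => hne (h ▸ rfl)
  · intro r x y hr hxy c c' hc hc' hne
    obtain ⟨s, rfl⟩ := hc.exists_eq_cons
    obtain ⟨s', rfl⟩ := hc'.exists_eq_cons
    -- A common completion above `y` places both chains in the enumeration.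
    obtain ⟨d, hd⟩ := exists_isSatChain (le_top (a := y))
    obtain ⟨i, hi⟩ := exists_index Γ hr hc hd
    obtain ⟨j, hj⟩ := exists_index Γ hr hc' hd
    have hij : i ≠ j := by
      rintro rfl
      rw [hi] at hj
      exact hne (by simpa using hj)
    have hpre : ¬ labelSeq (cutLabeling.{u, v} Γ) r (x :: s) <+:
        labelSeq (cutLabeling.{u, v} Γ) r (x :: s') := by
      rcases lt_or_gt_of_ne hij with h | h
      · exact (lexDiff_labelSeq hLC hr hc hc' hi hj h).not_prefix.1
      · exact (lexDiff_labelSeq hLC hr hc' hc hj hi h).not_prefix.2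
    exact ⟨fun h => hpre (h ▸ List.prefix_rfl), hpre⟩

end CutLabelingIsCC

/-! ### The cycle of implications -/

theorem AdmitsLCRFAS.ccShellable {P : Type u} [PartialOrder P] [BoundedOrder P] [Finite P]
    (h : AdmitsLCRFAS P) : CCShellable.{u, v} P := by
  obtain ⟨Ω, hΩ, t, Γ, hΓ, hLC⟩ := h
  exact ⟨_, _, _, hΩ.isCCLabeling_cutLabeling hΓ hLC⟩

theorem CCShellable.tclShellable {P : Type u} [PartialOrder P] [OrderBot P]
    (h : CCShellable.{u, v} P) : TCLShellable.{u, v} P := by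
  obtain ⟨Λ, _, lab, h⟩ := h
  exact ⟨Λ, _, lab, h.1⟩

theorem TCLShellable.admitsLCRFAS {P : Type u} [PartialOrder P] [BoundedOrder P] [Finite P]
    (h : TCLShellable.{u, v} P) : AdmitsLCRFAS P := by
  obtain ⟨_, _, _, h⟩ := h
  exact h.admitsLCRFAS

end LexShelling

theorem mainTheorem4 (P : Type u) [PartialOrder P] [BoundedOrder P] [Finite P] :
    (LexShelling.AdmitsLCRFAS P ↔ LexShelling.TCLShellable.{u, v} P) ∧
    (LexShelling.TCLShellable.{u, v} P ↔ LexShelling.CCShellable.{u, v} P) :=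
  ⟨⟨fun h => h.ccShellable.tclShellable, fun h => h.admitsLCRFAS⟩,
    ⟨fun h => h.admitsLCRFAS.ccShellable, fun h => h.tclShellable⟩⟩
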